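/- Let $\mathcal X$ be a finite alphabet, let $P_0,P_1$ be probability distributions on $\mathcal X$, and let $\log$ denote the logarithm to base $2$. Let $X_1,X_2,\dots$ be $\mathcal X$-valued observations which are i.i.d. with law $P_i$ under hypothesis $H_i$, $i=0,1$; write $X_1^n=(X_1,\dots,X_n)$, $P_i(x_1^n)=\prod_{k=1}^n P_i(x_k)$, and $E_i$ for expectation under $H_i$. Let $\lambda>0$, and let $L_n:\mathcal X^n\to\mathbb R$, $n\ge 1$, be length functions (for example the codeword lengths, in bits, of a universal source code). For $0<\alpha,\beta<1$ put $$\widehat W_n=-L_n(X_1^n)-\log P_0(X_1^n)-n\tfrac{\lambda}{2},\qquad N=\inf\{n\ge1:\widehat W_n\notin(\log\beta,-\log\alpha)\},$$ $$N^0=\inf\{n\ge1:\widehat W_n\le\log\beta\},\qquad N^1=\inf\{n\ge1:\widehat W_n\ge-\log\alpha\}$$ (with $\inf\emptyset=\infty$), and for $\epsilon>0$, $i=0,1$, $$N_i^*(\epsilon)=\sup\{n\ge1:|-L_n(X_1^n)-\log P_i(X_1^n)|>n\epsilon\}\in\{0,1,2,\dots\}\cup\{\infty\}$$ (with $\sup\emptyset=0$).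 All limits $\alpha,\beta\to0$ are joint limits through positive values, with no relation imposed between $\alpha$ and $\beta$. **(a)** Suppose that under $H_0$ one has $\frac1n\big(L_n(X_1^n)+\log P_0(X_1^n)\big)\to0$ a.s. Then, under $H_0$, $$\lim_{\alpha,\beta\to0}\frac{N}{|\log\beta|}=\frac2\lambda\quad\text{a.s.}$$ If moreover, for some real $p\ge1$, $E_0[N_0^*(\epsilon)^p]<\infty$ for all $\epsilon>0$ and $E_0[|\log P_0(X_1)|^{p+1}]<\infty$, then for all $0<q\le p$ $$\lim_{\alpha,\beta\to0}\frac{E_0[N^q]}{|\log\beta|^q}=\lim_{\alpha,\beta\to0}\frac{E_0[(N^0)^q]}{|\log\beta|^q}=\Big(\frac2\lambda\Big)^q .$$ **(b)** Suppose that $\lambda\le D(P_1\|P_0)<\infty$, where $D(P_1\|P_0)$ is the Kullback–Leibler divergence in bits, and that under $H_1$ one has $\frac1n\big(L_n(X_1^n)+\log P_1(X_1^n)\big)\to0$ a.s. Put $$\delta=E_1\Big[\log\frac{P_1(X_1)}{P_0(X_1)}\Big]-\frac\lambda2=D(P_1\|P_0)-\frac\lambda2,\qquad \rho^2=\operatorname{Var}_1\Big[\log\frac{P_1(X_1)}{P_0(X_1)}\Big].$$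 Then, under $H_1$, $$\lim_{\alpha,\beta\to0}\frac{N}{|\log\alpha|}=\frac1\delta\quad\text{a.s.}$$ If moreover, for some real $p\ge1$, $E_1[N_1^*(\epsilon)^p]<\infty$ for all $\epsilon>0$, $E_1[|\log P_1(X_1)|^{p+1}]<\infty$ and $E_1[|\log P_0(X_1)|^{p+1}]<\infty$, then for all $0<q\le p$ $$\lim_{\alpha,\beta\to0}\frac{E_1[N^q]}{|\log\alpha|^q}=\lim_{\alpha,\beta\to0}\frac{E_1[(N^1)^q]}{|\log\alpha|^q}=\Big(\frac1\delta\Big)^q .$$ If $0<\rho^2<\infty$ and $\big(L_n(X_1^n)+\log P_1(X_1^n)\big)/\sqrt n\to0$ a.s. under $H_1$, then under $H_1$ the time $N$ is a.s. finite for all $0<\alpha,\beta<1$, and as $\alpha,\beta\to0$ $$\frac{N-\delta^{-1}|\log\alpha|}{\sqrt{\rho^2\delta^{-3}|\log\alpha|}}\to\mathcal N(0,1)\quad\text{in distribution.}$$ -/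

import Mathlib

open MeasureTheory ProbabilityTheory Filter Topology InformationTheory
open scoped ENNReal

noncomputable section

namespace UniversalSequentialTest

variable {𝒳 Ω : Type*} [MeasurableSpace 𝒳] [MeasurableSpace Ω]

/-- Under `μ`, the observations `X 0, X 1, …` (that is, `X₁, X₂, …` in one-based indexing)
are independent with common law `P`. -/
structure IsIIDSample (X : ℕ → Ω → 𝒳) (P : Measure 𝒳) (μ : Measure Ω) : Prop where
  measurable : ∀ k, Measurable (X k)
  indep : iIndepFun X μ
  law : ∀ k, μ.map (X k) = P

/-- The data `X₁ⁿ`: the first `n` observations. -/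
def sample (X : ℕ → Ω → 𝒳) (n : ℕ) (ω : Ω) : Fin n → 𝒳 := fun i => X i ω

/-- `log₂ P(x₁ⁿ)` for the `n`-fold product of `P`. -/
def logProb (P : Measure 𝒳) {n : ℕ} (x : Fin n → 𝒳) : ℝ :=
  Real.logb 2 (∏ i, P.real {x i})

/-- The single-letter log-likelihood ratio `log₂ (P₁(x) / P₀(x))`. -/
def logLR (P₁ P₀ : Measure 𝒳) (x : 𝒳) : ℝ :=
  Real.logb 2 (P₁.real {x} / P₀.real {x})

/-- Kullback-Leibler divergence in bits (Mathlib's `klDiv` uses the natural logarithm). -/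
def klBits (P Q : Measure 𝒳) : ℝ≥0∞ := klDiv P Q / ENNReal.ofReal (Real.log 2)

/-- The pointwise redundancy `L_n(X₁ⁿ) + log₂ P(X₁ⁿ)` of the length function `L`. -/
def redundancy (L : (n : ℕ) → (Fin n → 𝒳) → ℝ) (P : Measure 𝒳) (X : ℕ → Ω → 𝒳)
    (n : ℕ) (ω : Ω) : ℝ :=
  L n (sample X n ω) + logProb P (sample X n ω)

/-- Pointwise universality of `L` for the source: the redundancy is `o(n)` almost surely. -/
def PointwiseUniversal (L : (n : ℕ) → (Fin n → 𝒳) → ℝ) (P : Measure 𝒳) (X : ℕ → Ω → 𝒳)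
    (μ : Measure Ω) : Prop :=
  ∀ᵐ ω ∂μ, Tendsto (fun n : ℕ => redundancy L P X n ω / n) atTop (𝓝 0)

/-- The test statistic `Ŵ_n = -L_n(X₁ⁿ) - log₂ P₀(X₁ⁿ) - n λ / 2`. -/
def testStat (L : (n : ℕ) → (Fin n → 𝒳) → ℝ) (P₀ : Measure 𝒳) (lam : ℝ) (X : ℕ → Ω → 𝒳)
    (n : ℕ) (ω : Ω) : ℝ :=
  -L n (sample X n ω) - logProb P₀ (sample X n ω) - n * (lam / 2)

/-- `N = inf {n ≥ 1 : w n ∉ (log₂ β, -log₂ α)}`, equal to `∞` if there is no such `n`. -/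
def stopN (w : ℕ → ℝ) (α β : ℝ) : ℕ∞ :=
  ⨅ n ∈ {n : ℕ | 1 ≤ n ∧ w n ∉ Set.Ioo (Real.logb 2 β) (-Real.logb 2 α)}, (n : ℕ∞)

/-- `N⁰ = inf {n ≥ 1 : w n ≤ log₂ β}`, equal to `∞` if there is no such `n`. -/
def stopN0 (w : ℕ → ℝ) (β : ℝ) : ℕ∞ :=
  ⨅ n ∈ {n : ℕ | 1 ≤ n ∧ w n ≤ Real.logb 2 β}, (n : ℕ∞)

/-- `N¹ = inf {n ≥ 1 : w n ≥ -log₂ α}`, equal to `∞` if there is no such `n`. -/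
def stopN1 (w : ℕ → ℝ) (α : ℝ) : ℕ∞ :=
  ⨅ n ∈ {n : ℕ | 1 ≤ n ∧ -Real.logb 2 α ≤ w n}, (n : ℕ∞)

/-- `N*(ε) = sup {n ≥ 1 : |-L_n(X₁ⁿ) - log₂ P(X₁ⁿ)| > n ε}`, equal to `0` if there is no such
`n` and to `∞` if the set is unbounded. -/
def lastDeviation (L : (n : ℕ) → (Fin n → 𝒳) → ℝ) (P : Measure 𝒳) (X : ℕ → Ω → 𝒳)
    (ε : ℝ) (ω : Ω) : ℕ∞ :=
  ⨆ n ∈ {n : ℕ | 1 ≤ n ∧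
    n * ε < |-L n (sample X n ω) - logProb P (sample X n ω)|}, (n : ℕ∞)

/-- `E_μ[T ^ q] ∈ [0, ∞]` for an extended-natural-valued random time `T`. -/
def timeMoment (μ : Measure Ω) (T : Ω → ℕ∞) (q : ℝ) : ℝ≥0∞ :=
  ∫⁻ ω, ((T ω : ℕ∞) : ℝ≥0∞) ^ q ∂μ

/-- `E_μ[|log₂ P(X₁)| ^ r] ∈ [0, ∞]`. -/
def logMoment (μ : Measure Ω) (P : Measure 𝒳) (X : ℕ → Ω → 𝒳) (r : ℝ) : ℝ≥0∞ :=
  ∫⁻ ω, ENNReal.ofReal (|Real.logb 2 (P.real {X 0 ω})| ^ r) ∂μ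

/-- `δ = E₁[log₂ (P₁(X₁) / P₀(X₁))] - λ / 2`, where `X₁` has law `P₁`. -/
def drift (P₁ P₀ : Measure 𝒳) (lam : ℝ) : ℝ := ∫ x, logLR P₁ P₀ x ∂P₁ - lam / 2

/-- The joint limit `α, β → 0` through positive values, for the pair `(α, β)`. -/
def errToZero : Filter (ℝ × ℝ) := 𝓝[>] (0 : ℝ) ×ˢ 𝓝[>] (0 : ℝ)

end UniversalSequentialTest

end

open UniversalSequentialTest

namespace UniversalSequentialTest

/-! Everything is a first passage problem for one path `w` with `w n / n → c > 0`. Under `H₀` the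
path is the negated statistic, redundancy plus `nλ/2`, so `c = λ/2`. Under `H₁` it is the statistic
itself, a random walk with drift `δ` minus the redundancy, so `c = δ`. Such a path is bounded below,
so a receding opposite barrier is eventually never met, however `α` and `β` are related. From `w (τ
- 1) < a ≤ w τ` one gets `τ / a → 1 / c` (`tendsto_passage_div`).

For moments, after its last time below the line `n c'` the path crosses `a` as soon as `n ≥ a / c'`.
Hence `τ / a` is dominated, for `a ≥ 1`, by that last time plus a constant
(`hitTime_le_lastBelow_add`), and dominated convergence applies. Under `H₀` the last time is at most
`N₀*`. Under `H₁` it is at most the larger of `N₁*` and a last time of the walk, which has all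
moments by Hoeffding since functions on a finite alphabet are bounded.

Asymptotic normality needs no central limit theorem at a random index. Hoeffding and Borel–Cantelli
give an almost sure modulus of continuity for the walk `u`, which allows `u τ` to be replaced by `u
⌊a/δ⌋` with error `o(√a)` (`tendsto_passage_add_div_sqrt`). Then `τ δ - a = -u ⌊a/δ⌋ + o(√a)`, and
the ordinary central limit theorem with Slutsky's lemma concludes. -/

/-- The first element of `s`, equal to `∞` if `s` is empty. -/
noncomputable def firstTime (s : Set ℕ) : ℕ∞ := ⨅ n ∈ s, (n : ℕ∞)

/-- The first time `n ≥ 1` at which `w` is at level `a` or above. -/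
noncomputable def hitTime (w : ℕ → ℝ) (a : ℝ) : ℕ∞ := firstTime {n | 1 ≤ n ∧ a ≤ w n}

/-- The first time `n ≥ 1` at which `w` is outside the open interval `(b, a)`. -/
noncomputable def exitTime (w : ℕ → ℝ) (b a : ℝ) : ℕ∞ :=
  firstTime {n | 1 ≤ n ∧ w n ∉ Set.Ioo b a}

/-- The last time `n ≥ 1` at which `w n < n c`. -/
noncomputable def lastBelow (w : ℕ → ℝ) (c : ℝ) : ℕ∞ :=
  ⨆ n ∈ {n : ℕ | 1 ≤ n ∧ w n < n * c}, (n : ℕ∞)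

/-! ### First passage of a single path -/

lemma firstTime_le {s : Set ℕ} {n : ℕ} (hn : n ∈ s) : firstTime s ≤ n := iInf₂_le n hn

lemma exists_firstTime_eq {s : Set ℕ} (hs : s.Nonempty) :
    ∃ n ∈ s, firstTime s = n ∧ ∀ k ∈ s, n ≤ k := by
  classical
  refine ⟨sInf s, Nat.sInf_mem hs, le_antisymm (firstTime_le (Nat.sInf_mem hs)) ?_,
    fun k hk => Nat.sInf_le hk⟩
  exact le_iInf₂ fun n hn => by exact_mod_cast Nat.sInf_le hn

lemma firstTime_anti {s t : Set ℕ} (h : s ⊆ t) : firstTime t ≤ firstTime s :=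
  biInf_mono h

lemma stopN_eq_exitTime (w : ℕ → ℝ) (α β : ℝ) :
    stopN w α β = exitTime w (Real.logb 2 β) (-Real.logb 2 α) := rfl

/-- Reflection swaps the two barriers, so that `H₀` also becomes an upward crossing. -/
lemma stopN_eq_exitTime_neg (w : ℕ → ℝ) (α β : ℝ) :
    stopN w α β = exitTime (fun n => -w n) (Real.logb 2 α) (-Real.logb 2 β) := by
  rw [stopN_eq_exitTime, exitTime, exitTime]
  congr 1
  ext n
  simp only [Set.mem_ofPred_eq, Set.mem_Ioo, neg_lt_neg_iff, lt_neg (b := w n), and_comm]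

lemma stopN0_eq_hitTime_neg (w : ℕ → ℝ) (β : ℝ) :
    stopN0 w β = hitTime (fun n => -w n) (-Real.logb 2 β) := by
  simp only [stopN0, hitTime, firstTime, neg_le_neg_iff]

lemma exitTime_le_hitTime (w : ℕ → ℝ) (b a : ℝ) : exitTime w b a ≤ hitTime w a :=
  firstTime_anti fun _ hn => ⟨hn.1, fun h => absurd h.2 (not_lt.2 hn.2)⟩

lemma tendsto_atTop_of_tendsto_div {w : ℕ → ℝ} {c : ℝ} (hc : 0 < c)
    (hw : Tendsto (fun n : ℕ => w n / n) atTop (𝓝 c)) : Tendsto w atTop atTop := by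
  refine (hw.pos_mul_atTop hc tendsto_natCast_atTop_atTop).congr' ?_
  filter_upwards [eventually_gt_atTop 0] with n hn
  field_simp

lemma exists_forall_lt {w : ℕ → ℝ} (hw : Tendsto w atTop atTop) : ∃ M, ∀ n, M < w n := by
  obtain ⟨N, hN⟩ := eventually_atTop.1 (hw.eventually_gt_atTop 0)
  obtain ⟨m, hm⟩ := ((Finset.range N).image w).bddBelow
  refine ⟨min m 0 - 1, fun n => ?_⟩
  by_cases h : N ≤ n
  · have := min_le_right m 0; linarith [hN n h]
  · have := hm (Finset.mem_coe.2 (Finset.mem_image_of_mem w (Finset.mem_range.2 (not_le.1 h))))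
    have := min_le_left m 0; linarith

lemma hitTime_nonempty {w : ℕ → ℝ} (hw : Tendsto w atTop atTop) (a : ℝ) :
    {n : ℕ | 1 ≤ n ∧ a ≤ w n}.Nonempty :=
  ((eventually_ge_atTop 1).and (hw.eventually_ge_atTop a)).exists

/-- A path tending to `+∞` has a finite lower bound, and the lower barrier eventually lies beneath
it. The upper levels `a` are arbitrary, so no relation between the two barriers is needed. -/
lemma eventually_exitTime_eq_hitTime {ι : Type*} {l : Filter ι} {w : ℕ → ℝ}
    (hw : Tendsto w atTop atTop) {b : ι → ℝ} (hb : Tendsto b l atBot) (a : ι → ℝ) :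
    ∀ᶠ i in l, exitTime w (b i) (a i) = hitTime w (a i) := by
  obtain ⟨M, hM⟩ := exists_forall_lt hw
  filter_upwards [hb.eventually_le_atBot M] with i hi
  rw [exitTime, hitTime]
  congr 1
  ext n
  simp [hi.trans_lt (hM n)]

/-- The first passage time as a natural number. -/
noncomputable def passage (w : ℕ → ℝ) (a : ℝ) : ℕ := (hitTime w a).toNat

lemma hitTime_eq_passage {w : ℕ → ℝ} (hw : Tendsto w atTop atTop) (a : ℝ) :
    hitTime w a = passage w a := by
  obtain ⟨n, -, h, -⟩ := exists_firstTime_eq (hitTime_nonempty hw a)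
  rw [passage, hitTime, h]; rfl

lemma passage_spec {w : ℕ → ℝ} (hw : Tendsto w atTop atTop) (a : ℝ) :
    1 ≤ passage w a ∧ a ≤ w (passage w a) ∧
      ∀ k, 1 ≤ k → a ≤ w k → passage w a ≤ k := by
  obtain ⟨n, hn, h, h'⟩ := exists_firstTime_eq (hitTime_nonempty hw a)
  have : passage w a = n := by rw [passage, hitTime, h]; rfl
  rw [this]
  exact ⟨hn.1, hn.2, fun k hk hk' => h' k ⟨hk, hk'⟩⟩

lemma tendsto_passage {w : ℕ → ℝ} (hw : Tendsto w atTop atTop) :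
    Tendsto (passage w) atTop atTop := by
  refine tendsto_atTop.2 fun m => ?_
  obtain ⟨M, hM⟩ := ((Finset.range m).image w).bddAbove
  filter_upwards [eventually_gt_atTop M] with a ha
  by_contra hlt
  have := hM (Finset.mem_coe.2 (Finset.mem_image_of_mem w (Finset.mem_range.2 (not_le.1 hlt))))
  linarith [(passage_spec hw a).2.1]

lemma eventually_passage_sub_one {w : ℕ → ℝ} (hw : Tendsto w atTop atTop) :
    ∀ᶠ a in atTop, w (passage w a - 1) < a := by
  filter_upwards [(tendsto_passage hw).eventually_ge_atTop 2] with a ha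
  by_contra h
  have := (passage_spec hw a).2.2 (passage w a - 1) (by omega) (not_lt.1 h)
  omega

/-- Divide `w (τ - 1) < a ≤ w τ` by `τ`: both ends tend to `c` because `τ → ∞`. -/
lemma tendsto_passage_div {w : ℕ → ℝ} {c : ℝ} (hc : 0 < c)
    (hw : Tendsto (fun n : ℕ => w n / n) atTop (𝓝 c)) :
    Tendsto (fun a => (passage w a : ℝ) / a) atTop (𝓝 (1 / c)) := by
  have hw' := tendsto_atTop_of_tendsto_div hc hw
  have hτ := tendsto_passage hw'
  have hshift : Tendsto (fun n : ℕ => w (n - 1) / n) atTop (𝓝 c) := by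
    rw [← tendsto_add_atTop_iff_nat 1]
    have := hw.mul (tendsto_natCast_div_add_atTop (1 : ℝ))
    rw [mul_one] at this
    refine this.congr' ?_
    filter_upwards [eventually_gt_atTop 0] with n hn
    simp only [add_tsub_cancel_right, Nat.cast_add, Nat.cast_one]
    field_simp
  have key : Tendsto (fun a => a / (passage w a : ℝ)) atTop (𝓝 c) := by
    refine tendsto_of_tendsto_of_tendsto_of_le_of_le' (hshift.comp hτ) (hw.comp hτ) ?_ ?_
    · filter_upwards [eventually_passage_sub_one hw'] with a ha
      simp only [Function.comp]
      gcongr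
    · filter_upwards with a
      simp only [Function.comp]
      gcongr
      exact (passage_spec hw' a).2.1
  simpa using key.inv₀ hc.ne'

lemma tendsto_hitTime_div {w : ℕ → ℝ} {c : ℝ} (hc : 0 < c)
    (hw : Tendsto (fun n : ℕ => w n / n) atTop (𝓝 c)) :
    Tendsto (fun a => ((hitTime w a : ℕ∞) : ℝ≥0∞) / ENNReal.ofReal a) atTop
      (𝓝 (ENNReal.ofReal (1 / c))) := by
  refine (ENNReal.tendsto_ofReal (tendsto_passage_div hc hw)).congr' ?_
  filter_upwards [eventually_gt_atTop 0] with a ha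
  rw [hitTime_eq_passage (tendsto_atTop_of_tendsto_div hc hw), ENNReal.ofReal_div_of_pos ha]
  simp

lemma tendsto_exitTime_div {ι : Type*} {l : Filter ι} {w : ℕ → ℝ} {c : ℝ} (hc : 0 < c)
    (hw : Tendsto (fun n : ℕ => w n / n) atTop (𝓝 c)) {a b : ι → ℝ}
    (ha : Tendsto a l atTop) (hb : Tendsto b l atBot) :
    Tendsto (fun i => ((exitTime w (b i) (a i) : ℕ∞) : ℝ≥0∞) / ENNReal.ofReal (a i)) l
      (𝓝 (ENNReal.ofReal (1 / c))) := by
  refine ((tendsto_hitTime_div hc hw).comp ha).congr' ?_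
  filter_upwards [eventually_exitTime_eq_hitTime (tendsto_atTop_of_tendsto_div hc hw) hb a]
    with i hi
  rw [hi]; rfl

/-- Past the last time below the line `n c` the path dominates that line, which reaches `a` at `n =
a / c`. The `2` pays for moving strictly past the last time and for rounding up. -/
lemma hitTime_le_lastBelow_add (w : ℕ → ℝ) {a c : ℝ} (hc : 0 < c) :
    ((hitTime w a : ℕ∞) : ℝ≥0∞) ≤ ((lastBelow w c : ℕ∞) : ℝ≥0∞) + 2 + ENNReal.ofReal (a / c) := by
  by_cases htop : lastBelow w c = ⊤
  · simp [htop]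
  obtain ⟨K, hK⟩ := ENat.ne_top_iff_exists.1 htop
  have hgood : ∀ n : ℕ, K < n → n * c ≤ w n := by
    intro n hn
    by_contra h
    have h1 : (n : ℕ∞) ≤ lastBelow w c :=
      le_iSup₂ (f := fun (n : ℕ) (_ : n ∈ {n : ℕ | 1 ≤ n ∧ w n < n * c}) => (n : ℕ∞)) n
        ⟨by omega, not_le.1 h⟩
    rw [← hK] at h1
    have : n ≤ K := by exact_mod_cast h1
    omega
  set m := K + 1 + ⌈a / c⌉₊ with hm
  have h1 : a ≤ w m := by
    refine le_trans ?_ (hgood m (by omega))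
    rw [← div_le_iff₀ hc]
    refine (Nat.le_ceil _).trans ?_
    exact_mod_cast (by omega : ⌈a / c⌉₊ ≤ m)
  have h2 : hitTime w a ≤ m := firstTime_le ⟨by omega, h1⟩
  have h3 : ((hitTime w a : ℕ∞) : ℝ≥0∞) ≤ (m : ℝ≥0∞) := by
    have := ENat.toENNReal_le.2 h2
    simpa using this
  refine h3.trans ?_
  have h4 : ((⌈a / c⌉₊ : ℕ) : ℝ≥0∞) ≤ 1 + ENNReal.ofReal (a / c) := by
    rcases le_total 0 (a / c) with h | h
    · rw [← ENNReal.ofReal_natCast, ← ENNReal.ofReal_one, ← ENNReal.ofReal_add zero_le_one h]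
      exact ENNReal.ofReal_le_ofReal (by linarith [Nat.ceil_lt_add_one h])
    · simp [Nat.ceil_eq_zero.2 h]
  rw [← hK, hm]
  push_cast
  calc (K : ℝ≥0∞) + 1 + (⌈a / c⌉₊ : ℝ≥0∞) ≤ K + 1 + (1 + ENNReal.ofReal (a / c)) := by gcongr
    _ = _ := by rw [← one_add_one_eq_two]; ring

/-! ### Measurability and convergence of moments -/

lemma borelSpace_enat : BorelSpace ℕ∞ := by
  refine ⟨le_antisymm (fun t _ => ?_) le_top⟩
  let _ := borel ℕ∞
  have : BorelSpace ℕ∞ := ⟨rfl⟩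
  exact (Set.to_countable t).measurableSet

variable {Ω : Type*} [MeasurableSpace Ω]

lemma measurable_firstTime {s : Ω → Set ℕ} (hs : ∀ n, MeasurableSet {ω | n ∈ s ω}) :
    Measurable fun ω => firstTime (s ω) := by
  classical
  have := borelSpace_enat
  simp only [firstTime, iInf_eq_if]
  exact Measurable.iInf fun n => Measurable.ite (hs n) measurable_const measurable_const

lemma measurable_hitTime {w : ℕ → Ω → ℝ} (hw : ∀ n, Measurable (w n)) (a : ℝ) :
    Measurable fun ω => hitTime (fun n => w n ω) a :=
  measurable_firstTime fun n => (MeasurableSet.const _).inter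
    (measurableSet_le measurable_const (hw n))

lemma measurable_exitTime {w : ℕ → Ω → ℝ} (hw : ∀ n, Measurable (w n)) (b a : ℝ) :
    Measurable fun ω => exitTime (fun n => w n ω) b a :=
  measurable_firstTime fun n => (MeasurableSet.const _).inter
    ((hw n) measurableSet_Ioo).compl

/-- Convergence of the moments of first passage times, by dominated convergence. -/
lemma tendsto_timeMoment_div {ι : Type*} {l : Filter ι} [l.IsCountablyGenerated]
    {μ : Measure Ω} [IsProbabilityMeasure μ] {w : ℕ → Ω → ℝ} {T : ι → Ω → ℕ∞} {a : ι → ℝ}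
    {c c' p q : ℝ} (hc : 0 < c) (hc' : 0 < c') (hp : 1 ≤ p) (hq : 0 < q) (hqp : q ≤ p)
    (ha : Tendsto a l atTop) (hT : ∀ i, Measurable (T i))
    (hTw : ∀ i ω, T i ω ≤ hitTime (fun n => w n ω) (a i))
    (hlim : ∀ᵐ ω ∂μ, Tendsto (fun i => ((T i ω : ℕ∞) : ℝ≥0∞) / ENNReal.ofReal (a i)) l
      (𝓝 (ENNReal.ofReal (1 / c))))
    (hK : timeMoment μ (fun ω => lastBelow (fun n => w n ω) c') p < ∞) :
    Tendsto (fun i => timeMoment μ (T i) q / ENNReal.ofReal (a i ^ q)) l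
      (𝓝 (ENNReal.ofReal ((1 / c) ^ q))) := by
  set C : ℝ≥0∞ := 2 + ENNReal.ofReal (1 / c') with hC
  have hCtop : C ≠ ∞ := by simp [hC]
  set K : Ω → ℝ≥0∞ := fun ω => ((lastBelow (fun n => w n ω) c' : ℕ∞) : ℝ≥0∞) with hKdef
  have hp0 : 0 < p := hq.trans_le hqp
  have hfin : ∫⁻ ω, 2 ^ (p - 1) * (K ω ^ p + C ^ p) ∂μ ≠ ∞ := by
    have h2 : (2 : ℝ≥0∞) ^ (p - 1) ≠ ∞ := by simp
    rw [lintegral_const_mul' _ _ h2, lintegral_add_right _ measurable_const]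
    refine ENNReal.mul_ne_top h2 (ENNReal.add_ne_top.2 ⟨hK.ne, ?_⟩)
    simpa using ENNReal.rpow_ne_top_of_nonneg hp0.le hCtop
  have hbound : ∀ᶠ i in l, ∀ᵐ ω ∂μ,
      (((T i ω : ℕ∞) : ℝ≥0∞) / ENNReal.ofReal (a i)) ^ q ≤ 2 ^ (p - 1) * (K ω ^ p + C ^ p) := by
    filter_upwards [ha.eventually_ge_atTop 1] with i hi
    refine Eventually.of_forall fun ω => ?_
    have ha0 : 0 < a i := by linarith
    have hone : (1 : ℝ≥0∞) ≤ ENNReal.ofReal (a i) := by simpa using hi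
    have h1 : ((T i ω : ℕ∞) : ℝ≥0∞) / ENNReal.ofReal (a i) ≤ K ω + C := by
      have h := (ENat.toENNReal_le.2 (hTw i ω)).trans (hitTime_le_lastBelow_add _ (a := a i) hc')
      refine ENNReal.div_le_of_le_mul (h.trans ?_)
      have h3 : ENNReal.ofReal (a i / c') = ENNReal.ofReal (1 / c') * ENNReal.ofReal (a i) := by
        rw [← ENNReal.ofReal_mul (by positivity)]; congr 1; ring
      rw [h3, hC, ← add_assoc, add_mul]
      gcongr
      exact le_mul_of_one_le_right' hone
    -- A base at least `1` is what allows the exponent `q` to be raised to `p`.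
    have h2 : 1 ≤ K ω + C := by
      rw [hC, ← add_assoc]
      exact le_add_right (le_add_left one_le_two)
    calc _ ≤ (K ω + C) ^ q := ENNReal.rpow_le_rpow h1 hq.le
      _ ≤ (K ω + C) ^ p := ENNReal.rpow_le_rpow_of_exponent_le h2 hqp
      _ ≤ _ := ENNReal.rpow_add_le_mul_rpow_add_rpow _ _ hp
  have hmeas : ∀ i, Measurable fun ω => ((T i ω : ℕ∞) : ℝ≥0∞) := fun i =>
    Measurable.of_discrete.comp (hT i)
  have key := tendsto_lintegral_filter_of_dominated_convergence
    (F := fun i ω => (((T i ω : ℕ∞) : ℝ≥0∞) / ENNReal.ofReal (a i)) ^ q)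
    (f := fun _ => ENNReal.ofReal (1 / c) ^ q) _
    (Eventually.of_forall fun i => ((hmeas i).div_const _).pow_const q) hbound hfin
    (by filter_upwards [hlim] with ω hω
        exact (ENNReal.continuous_rpow_const.tendsto _).comp hω)
  rw [lintegral_const, measure_univ, mul_one, ENNReal.ofReal_rpow_of_pos (by positivity)] at key
  refine key.congr' ?_
  filter_upwards [ha.eventually_ge_atTop 1] with i hi
  have ha0 : 0 < a i := by linarith
  simp only [ENNReal.div_rpow_of_nonneg _ _ hq.le, timeMoment, ENNReal.ofReal_rpow_of_pos ha0]
  simp only [div_eq_mul_inv]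
  rw [lintegral_mul_const' _ _ (by simp [Real.rpow_pos_of_pos ha0])]

/-! ### The thresholds in the joint limit -/

lemma tendsto_neg_logb_two : Tendsto (fun x => -Real.logb 2 x) (𝓝[>] 0) atTop :=
  tendsto_neg_atBot_atTop.comp (Real.tendsto_logb_nhdsGT_zero one_lt_two)

lemma tendsto_neg_logb_fst :
    Tendsto (fun e : ℝ × ℝ => -Real.logb 2 e.1) errToZero atTop :=
  tendsto_neg_logb_two.comp tendsto_fst

lemma tendsto_neg_logb_snd :
    Tendsto (fun e : ℝ × ℝ => -Real.logb 2 e.2) errToZero atTop :=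
  tendsto_neg_logb_two.comp tendsto_snd

lemma tendsto_logb_fst : Tendsto (fun e : ℝ × ℝ => Real.logb 2 e.1) errToZero atBot := 
  (Real.tendsto_logb_nhdsGT_zero one_lt_two).comp tendsto_fst

lemma tendsto_logb_snd : Tendsto (fun e : ℝ × ℝ => Real.logb 2 e.2) errToZero atBot := 
  (Real.tendsto_logb_nhdsGT_zero one_lt_two).comp tendsto_snd

/-- Dominated convergence, and the passage from almost sure convergence to convergence in measure,
hold only along countably generated filters. -/
instance : errToZero.IsCountablyGenerated := by
  unfold errToZero; infer_instance

lemma eventually_abs_logb_fst :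
    ∀ᶠ e : ℝ × ℝ in errToZero, |Real.logb 2 e.1| = -Real.logb 2 e.1 := by
  filter_upwards [tendsto_logb_fst.eventually_le_atBot 0] with e he using abs_of_nonpos he

lemma eventually_abs_logb_snd :
    ∀ᶠ e : ℝ × ℝ in errToZero, |Real.logb 2 e.2| = -Real.logb 2 e.2 := by
  filter_upwards [tendsto_logb_snd.eventually_le_atBot 0] with e he using abs_of_nonpos he

/-! ### Second-order expansion of the passage time along a path -/

open Asymptotics

/-- Along a path `w n = n d + u n - r n` with bounded steps of `u`, a negligible `r` and a modulus of
continuity for `u`, the first passage time over `a` is governed by `u` at time `⌊a / d⌋`. -/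
lemma tendsto_passage_add_div_sqrt {u r w : ℕ → ℝ} {d B A : ℝ} (hd : 0 < d)
    (hw : ∀ n, w n = n * d + u n - r n) (hu0 : u 0 = 0)
    (hB : ∀ n, |u (n + 1) - u n| ≤ B)
    (hr : Tendsto (fun n : ℕ => r n / √n) atTop (𝓝 0))
    (hmod : ∀ᶠ m : ℕ in atTop, ∀ n ≤ m, |u m - u n| ^ 2 ≤ A * (m - n) * Real.log m)
    (hlim : Tendsto (fun n : ℕ => w n / n) atTop (𝓝 d)) :
    Tendsto (fun a : ℝ => (passage w a * d - a + u ⌊a / d⌋₊) / √a) atTop (𝓝 0) := by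
  have hw' := tendsto_atTop_of_tendsto_div hd hlim
  set τ := passage w with hτdef
  have hτ : Tendsto τ atTop atTop := tendsto_passage hw'
  have hτa := tendsto_passage_div hd hlim
  have hτO : (fun a => (τ a : ℝ)) =O[atTop] (fun a : ℝ => a) := by
    refine (isBigO_of_div_tendsto_nhds ?_ _ hτa)
    filter_upwards [eventually_gt_atTop 0] with a ha h0
    exact absurd h0 ha.ne'
  have hν : Tendsto (fun a : ℝ => ⌊a / d⌋₊) atTop atTop :=
    tendsto_nat_floor_atTop.comp (tendsto_id.atTop_div_const hd)
  have hνbd : ∀ᶠ a : ℝ in atTop, |(⌊a / d⌋₊ : ℝ) - a / d| ≤ 1 := by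
    filter_upwards [eventually_ge_atTop 0] with a ha
    have h1 := Nat.floor_le (div_nonneg ha hd.le)
    have h2 := Nat.lt_floor_add_one (a / d)
    rw [abs_le]; constructor <;> linarith
  have hνO : (fun a : ℝ => ((⌊a / d⌋₊ : ℕ) : ℝ)) =O[atTop] (fun a : ℝ => a) := by
    refine IsBigO.of_bound (1 / d) ?_
    filter_upwards [eventually_ge_atTop 0] with a ha
    rw [Real.norm_of_nonneg (by positivity), Real.norm_of_nonneg ha]
    calc _ ≤ a / d := Nat.floor_le (div_nonneg ha hd.le)
      _ = _ := by ring
  -- the value at the passage time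
  have hro : r =o[atTop] (fun n : ℕ => √(n : ℝ)) := by
    rw [isLittleO_iff_tendsto' ?_]
    · exact hr
    · filter_upwards [eventually_gt_atTop 0] with n hn h0
      exact absurd h0 (by positivity)
  have hsqrtO : (fun a => √(τ a : ℝ)) =O[atTop] (fun a : ℝ => √a) := by
    simp only [Real.sqrt_eq_rpow]
    exact hτO.rpow (by norm_num) (eventually_ge_atTop 0)
  have hr1 : (fun a => r (τ a)) =o[atTop] (fun a : ℝ => √a) :=
    (hro.comp_tendsto hτ).trans_isBigO hsqrtO
  have hτ1 : Tendsto (fun a => τ a - 1) atTop atTop := (tendsto_sub_atTop_nat 1).comp hτ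
  have hr2 : (fun a => r (τ a - 1)) =o[atTop] (fun a : ℝ => √a) := by
    refine (hro.comp_tendsto hτ1).trans_isBigO (IsBigO.trans ?_ hsqrtO)
    refine IsBigO.of_bound 1 (Eventually.of_forall fun a => ?_)
    simp only [Function.comp, Real.norm_of_nonneg (Real.sqrt_nonneg _), one_mul]
    gcongr
    omega
  have hconst : ∀ k : ℝ, (fun _ : ℝ => k) =o[atTop] (fun a : ℝ => √a) := fun k =>
    isLittleO_const_left.2 (Or.inr (tendsto_norm_atTop_atTop.comp Real.tendsto_sqrt_atTop))
  -- The overshoot: `a ≤ w τ` bounds the expression below by `r τ`, and `w (τ - 1) < a` bounds it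
  -- above by `d + B + r (τ - 1)`.
  have hover : (fun a => τ a * d - a + u (τ a)) =o[atTop] (fun a : ℝ => √a) := by
    refine IsBigO.trans_isLittleO (IsBigO.of_bound 1 ?_)
      ((hconst (d + B)).add (hr1.norm_left.add hr2.norm_left))
    filter_upwards [eventually_passage_sub_one hw'] with a ha
    obtain ⟨h1, h2, -⟩ := passage_spec hw' a
    have hB' := hB (τ a - 1)
    rw [Nat.sub_add_cancel h1] at hB'
    rw [hw, ← hτdef] at h2
    rw [hw, ← hτdef, Nat.cast_sub h1, Nat.cast_one] at ha
    have hB0 : 0 ≤ B := (abs_nonneg _).trans hB'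
    have hBl := (abs_le.1 hB').2
    have e1 := neg_abs_le (r (τ a))
    have e2 := le_abs_self (r (τ a - 1))
    have e3 := abs_nonneg (r (τ a - 1))
    have e4 := abs_nonneg (r (τ a))
    rw [one_mul, Real.norm_eq_abs, Real.norm_eq_abs, Real.norm_eq_abs, Real.norm_eq_abs]
    refine (abs_le.2 ⟨?_, ?_⟩).trans (le_abs_self _) <;> linarith
  -- growth of `u`
  have hlog : ∀ s : ℝ, 0 < s → (fun n : ℕ => Real.log n) =o[atTop] (fun n : ℕ => (n : ℝ) ^ s) :=
    fun s hs => (isLittleO_log_rpow_atTop hs).comp_tendsto tendsto_natCast_atTop_atTop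
  -- The modulus at `n = 0` gives `u m ^ 2 ≤ A m log m = o(m ^ (3/2))`. The exponent `3/4` leaves a
  -- factor `a ^ (1/4)` below to absorb a logarithm.
  have huo : u =o[atTop] (fun n : ℕ => (n : ℝ) ^ (3 / 4 : ℝ)) := by
    refine IsLittleO.of_pow (n := 2) ?_ two_ne_zero
    have h1 : (fun n : ℕ => A * n * Real.log n) =o[atTop]
        (fun n : ℕ => (n : ℝ) * (n : ℝ) ^ (1 / 2 : ℝ)) :=
      (isBigO_const_mul_self A (fun n : ℕ => (n : ℝ)) atTop).mul_isLittleO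
        (hlog (1 / 2) (by norm_num))
    refine IsBigO.trans_isLittleO (IsBigO.of_bound 1 ?_) (h1.congr_right fun n => ?_)
    · filter_upwards [hmod] with n hn
      have := hn 0 (Nat.zero_le n)
      rw [hu0, sub_zero, Nat.cast_zero, sub_zero] at this
      simpa using this.trans (le_abs_self _)
    · rw [Pi.pow_apply, ← Real.rpow_natCast, ← Real.rpow_mul (by positivity)]
      nth_rw 1 [← Real.rpow_one (n : ℝ)]
      rcases Nat.eq_zero_or_pos n with rfl | hn
      · simp
      · rw [← Real.rpow_add (by positivity)]; norm_num
  have h34 : (fun a : ℝ => √a) =O[atTop] (fun a : ℝ => a ^ (3 / 4 : ℝ)) := by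
    simp only [Real.sqrt_eq_rpow]
    refine IsBigO.of_bound 1 ?_
    filter_upwards [eventually_ge_atTop 1] with a ha
    rw [Real.norm_of_nonneg (by positivity), Real.norm_of_nonneg (by positivity), one_mul]
    exact Real.rpow_le_rpow_of_exponent_le ha (by norm_num)
  have huτ : (fun a => u (τ a)) =o[atTop] (fun a : ℝ => a ^ (3 / 4 : ℝ)) :=
    (huo.comp_tendsto hτ).trans_isBigO (hτO.rpow (by norm_num) (eventually_ge_atTop 0))
  have hdiff : (fun a => (τ a : ℝ) - ⌊a / d⌋₊) =o[atTop] (fun a : ℝ => a ^ (3 / 4 : ℝ)) := by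
    have h1 : (fun a => (τ a * d - a + u (τ a)) - u (τ a)) =o[atTop]
        (fun a : ℝ => a ^ (3 / 4 : ℝ)) := (hover.trans_isBigO h34).sub huτ
    have h2 : (fun a : ℝ => (⌊a / d⌋₊ : ℝ) - a / d) =o[atTop] (fun a : ℝ => a ^ (3 / 4 : ℝ)) := by
      refine IsBigO.trans_isLittleO (IsBigO.of_bound 1 ?_) ((hconst 1).trans_isBigO h34)
      simpa using hνbd
    refine ((h1.const_mul_left (1 / d)).sub h2).congr_left fun a => ?_
    field_simp
    ring
  -- the increment of `u` between the two times
  set M : ℝ → ℕ := fun a => max (τ a) ⌊a / d⌋₊ with hM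
  have hMtop : Tendsto M atTop atTop := tendsto_atTop_mono (fun a => le_max_left _ _) hτ
  have hMO : (fun a => (M a : ℝ)) =O[atTop] (fun a : ℝ => a) := by
    refine IsBigO.trans (IsBigO.of_bound 1 ?_) (hτO.add hνO)
    filter_upwards with a
    rw [Real.norm_of_nonneg (by positivity), Real.norm_of_nonneg (by positivity), one_mul]
    exact_mod_cast max_le (Nat.le_add_right _ _) (Nat.le_add_left _ _)
  have hlogM : (fun a => Real.log (M a)) =o[atTop] (fun a : ℝ => a ^ (1 / 4 : ℝ)) :=
    ((hlog (1 / 4) (by norm_num)).comp_tendsto hMtop).trans_isBigO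
      (hMO.rpow (by norm_num) (eventually_ge_atTop 0))
  -- By the modulus at the larger time `M`, the squared increment is at most `A · o(a ^ (3/4)) · o(a
  -- ^ (1/4)) = o(a)`.
  have hinc : (fun a => u (τ a) - u ⌊a / d⌋₊) =o[atTop] (fun a : ℝ => √a) := by
    refine IsLittleO.of_pow (n := 2) ?_ two_ne_zero
    have h1 := (hdiff.const_mul_left A).mul hlogM
    refine IsBigO.trans_isLittleO (IsBigO.of_bound 1 ?_) (h1.congr' EventuallyEq.rfl ?_)
    · filter_upwards [hMtop.eventually hmod] with a ha
      simp only [Pi.pow_apply, norm_pow, Real.norm_eq_abs, one_mul]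
      rcases le_total ⌊a / d⌋₊ (τ a) with h | h
      · have hMa : M a = τ a := max_eq_left h
        rw [hMa] at ha ⊢
        exact (ha _ h).trans (le_abs_self _)
      · have hMa : M a = ⌊a / d⌋₊ := max_eq_right h
        rw [hMa] at ha ⊢
        have := ha _ h
        rw [abs_sub_comm] at this
        refine this.trans ?_
        rw [abs_mul, abs_mul, abs_sub_comm, ← abs_mul, ← abs_mul]
        exact le_abs_self _
    · filter_upwards [eventually_gt_atTop 0] with a ha
      rw [← Real.rpow_add ha, Pi.pow_apply, Real.sq_sqrt ha.le]
      norm_num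
  have hfinal := (hover.sub hinc).tendsto_div_nhds_zero
  refine hfinal.congr fun a => ?_
  congr 1
  ring

lemma exists_abs_le {𝒳 : Type*} [Fintype 𝒳] (f : 𝒳 → ℝ) : ∃ B : ℝ, 0 < B ∧ ∀ x, |f x| ≤ B := by
  refine ⟨∑ x, |f x| + 1, by positivity, fun x => ?_⟩
  have := Finset.single_le_sum (f := fun x => |f x|) (fun i _ => abs_nonneg _) (Finset.mem_univ x)
  linarith

/-! ### Concentration and modulus of continuity of the centered walk -/

section IID

variable {𝒳 Ω : Type*} [Fintype 𝒳] [MeasurableSpace 𝒳] [MeasurableSingletonClass 𝒳]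
  [MeasurableSpace Ω] {X : ℕ → Ω → 𝒳} {P : Measure 𝒳} {μ : Measure Ω}

/-- The partial sums of `f (X k)`, centered by the mean of `f` under `P`. -/
noncomputable def centeredSum (f : 𝒳 → ℝ) (P : Measure 𝒳) (X : ℕ → Ω → 𝒳) (n : ℕ) (ω : Ω) : ℝ :=
  ∑ k ∈ Finset.range n, (f (X k ω) - ∫ x, f x ∂P)

lemma IsIIDSample.integral_comp (h : IsIIDSample X P μ) (f : 𝒳 → ℝ) (k : ℕ) :
    ∫ ω, f (X k ω) ∂μ = ∫ x, f x ∂P := by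
  rw [← h.law k, integral_map (h.measurable k).aemeasurable
    (measurable_of_finite f).aestronglyMeasurable]

lemma IsIIDSample.identDistrib (h : IsIIDSample X P μ) (f : 𝒳 → ℝ) (k : ℕ) :
    IdentDistrib (fun ω => f (X k ω)) (fun ω => f (X 0 ω)) μ μ :=
  IdentDistrib.comp (u := f) ⟨(h.measurable k).aemeasurable, (h.measurable 0).aemeasurable,
    (h.law k).trans (h.law 0).symm⟩ (measurable_of_finite f)

lemma IsIIDSample.iIndepFun_comp (h : IsIIDSample X P μ) (f : 𝒳 → ℝ) :
    iIndepFun (fun k ω => f (X k ω)) μ :=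
  h.indep.comp (fun _ => f) fun _ => measurable_of_finite f

/-- Hoeffding's inequality for the centered sums of a function of a sample from a finite
alphabet. -/
lemma IsIIDSample.exists_tail_bound [IsProbabilityMeasure μ] (h : IsIIDSample X P μ) (f : 𝒳 → ℝ) :
    ∃ κ : ℝ, 0 < κ ∧ ∀ (s : Finset ℕ) (t : ℝ), 0 ≤ t →
      μ.real {ω | t ≤ |∑ k ∈ s, (f (X k ω) - ∫ x, f x ∂P)|} ≤
        2 * Real.exp (-(κ * t ^ 2 / s.card)) := by
  obtain ⟨B, hB0, hB⟩ := exists_abs_le f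
  set c : NNReal := (‖B - (-B)‖₊ / 2) ^ 2 with hc
  have hc0 : 0 < (c : ℝ) := by
    have : B - -B ≠ 0 := by linarith
    simp only [hc, NNReal.coe_pow, NNReal.coe_div, coe_nnnorm, NNReal.coe_ofNat]
    positivity
  have hsub : ∀ k, HasSubgaussianMGF (fun ω => f (X k ω) - ∫ x, f x ∂P) c μ := fun k => by
    rw [← h.integral_comp f k]
    exact hasSubgaussianMGF_of_mem_Icc
      ((measurable_of_finite f).comp (h.measurable k)).aemeasurable
      (Eventually.of_forall fun ω => abs_le.1 (hB _))
  have hind : iIndepFun (fun k ω => f (X k ω) - ∫ x, f x ∂P) μ :=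
    h.iIndepFun_comp fun x => f x - ∫ x, f x ∂P
  have hind' : iIndepFun (fun k ω => -(f (X k ω) - ∫ x, f x ∂P)) μ :=
    h.iIndepFun_comp fun x => -(f x - ∫ x, f x ∂P)
  refine ⟨1 / (2 * c), by positivity, fun s t ht => ?_⟩
  have h1 := HasSubgaussianMGF.measure_sum_ge_le_of_iIndepFun hind
    (s := s) (fun k _ => hsub k) ht
  have h2 := HasSubgaussianMGF.measure_sum_ge_le_of_iIndepFun hind'
    (s := s) (fun k _ => (hsub k).neg) ht
  have hE : -t ^ 2 / (2 * ∑ k ∈ s, (c : ℝ)) = -(1 / (2 * c) * t ^ 2 / s.card) := by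
    rw [Finset.sum_const, nsmul_eq_mul]
    -- For empty `s` both exponents are `0`, by the convention for division by zero.
    rcases Nat.eq_zero_or_pos s.card with h0 | h0
    · simp [h0]
    · field_simp
  push_cast at h1 h2
  rw [hE] at h1 h2
  calc _ ≤ μ.real ({ω | t ≤ ∑ k ∈ s, (f (X k ω) - ∫ x, f x ∂P)} ∪
        {ω | t ≤ ∑ k ∈ s, -(f (X k ω) - ∫ x, f x ∂P)}) := by
        refine measureReal_mono fun ω hω => ?_
        rcases le_abs.1 (show t ≤ |_| from hω) with h | h
        · exact Or.inl h
        · refine Or.inr ?_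
          change t ≤ ∑ k ∈ s, -(f (X k ω) - ∫ x, f x ∂P)
          rwa [Finset.sum_neg_distrib]
    _ ≤ _ := (measureReal_union_le _ _).trans (by linarith)

lemma measurable_centeredSum (hX : ∀ k, Measurable (X k)) (f : 𝒳 → ℝ) (n : ℕ) :
    Measurable (centeredSum f P X n) := by
  unfold centeredSum
  exact Finset.measurable_fun_sum _ fun k _ =>
    ((measurable_of_finite f).comp (hX k)).sub_const _

/-- Almost surely, the increments of the centered sums before time `m` are eventually bounded by a
multiple of the square root of their length times `log m`. -/
lemma IsIIDSample.ae_modulus [IsProbabilityMeasure μ] (h : IsIIDSample X P μ) (f : 𝒳 → ℝ) :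
    ∃ A : ℝ, ∀ᵐ ω ∂μ, ∀ᶠ m : ℕ in atTop, ∀ n ≤ m,
      |centeredSum f P X m ω - centeredSum f P X n ω| ^ 2 ≤ A * (m - n) * Real.log m := by
  obtain ⟨κ, hκ, htail⟩ := h.exists_tail_bound f
  -- With this constant Hoeffding gives `2 m⁻³` for each start `n`. The union over the `m` starts
  -- costs a factor `m` and leaves the summable `2 m⁻²`.
  refine ⟨3 / κ, ?_⟩
  set bad : ℕ → Set Ω := fun m => ⋃ n ∈ Finset.range m,
    {ω | √(3 / κ * (m - n) * Real.log m) ≤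
      |∑ k ∈ Finset.Ico n m, (f (X k ω) - ∫ x, f x ∂P)|} with hbad
  have hle : ∀ m, μ (bad (m + 1)) ≤ ENNReal.ofReal (2 * (((m + 1 : ℕ) : ℝ) ^ 2)⁻¹) := by
    intro m
    set M := m + 1 with hM
    have hM0 : (0 : ℝ) < M := by positivity
    calc μ (bad M) ≤ ∑ n ∈ Finset.range M, μ {ω | √(3 / κ * (M - n) * Real.log M) ≤
          |∑ k ∈ Finset.Ico n M, (f (X k ω) - ∫ x, f x ∂P)|} := measure_biUnion_finset_le _ _
      _ ≤ ∑ n ∈ Finset.range M, ENNReal.ofReal (2 * ((M : ℝ) ^ 3)⁻¹) := by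
          refine Finset.sum_le_sum fun n hn => ?_
          have hn' : n < M := Finset.mem_range.1 hn
          have hpos : (0 : ℝ) < M - n := sub_pos.2 (by exact_mod_cast hn')
          have hlog : 0 ≤ Real.log M := Real.log_natCast_nonneg M
          rw [← ofReal_measureReal]
          refine ENNReal.ofReal_le_ofReal ((htail _ _ (Real.sqrt_nonneg _)).trans (le_of_eq ?_))
          rw [Real.sq_sqrt (by positivity), Nat.card_Ico, Nat.cast_sub hn'.le,
            ← Real.exp_log (show 0 < (M : ℝ) ^ 3 by positivity), ← Real.exp_neg, Real.log_pow]
          congr 3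
          have := hpos.ne'
          field_simp
          push_cast
          ring
      _ = ENNReal.ofReal (2 * ((M : ℝ) ^ 2)⁻¹) := by
          rw [Finset.sum_const, Finset.card_range, nsmul_eq_mul, ← ENNReal.ofReal_natCast,
            ← ENNReal.ofReal_mul hM0.le]
          congr 1
          field_simp
  have hsum : ∑' m, μ (bad (m + 1)) ≠ ∞ := by
    refine ne_top_of_le_ne_top ?_ (ENNReal.tsum_le_tsum hle)
    have : Summable fun m : ℕ => 2 * (((m + 1 : ℕ) : ℝ) ^ 2)⁻¹ :=
      ((summable_nat_add_iff (f := fun m : ℕ => ((m : ℝ) ^ 2)⁻¹) 1).2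
        (Real.summable_nat_pow_inv.2 one_lt_two)).mul_left 2
    exact this.tsum_ofReal_ne_top
  filter_upwards [ae_eventually_notMem hsum] with ω hω
  have hω' : ∀ᶠ m in atTop, ω ∉ bad m := by
    rw [eventually_atTop] at hω ⊢
    obtain ⟨N, hN⟩ := hω
    refine ⟨N + 1, fun m hm => ?_⟩
    have := hN (m - 1) (by omega)
    rwa [Nat.sub_add_cancel (by omega)] at this
  filter_upwards [hω'] with m hm n hn
  rcases hn.eq_or_lt with rfl | hlt
  · simp
  · have h1 : ω ∉ {ω | √(3 / κ * (m - n) * Real.log m) ≤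
        |∑ k ∈ Finset.Ico n m, (f (X k ω) - ∫ x, f x ∂P)|} := fun hmem =>
      hm (Set.mem_biUnion (Finset.mem_coe.2 (Finset.mem_range.2 hlt)) hmem)
    have h2 := (not_le.1 (fun hmem => h1 (Set.mem_ofPred_eq ▸ hmem) :
      ¬ √(3 / κ * (m - n) * Real.log m) ≤ |∑ k ∈ Finset.Ico n m, (f (X k ω) - ∫ x, f x ∂P)|)).le
    rw [Finset.sum_Ico_eq_sub _ hn] at h2
    have hlog : 0 ≤ Real.log m := Real.log_natCast_nonneg m
    have hpos : (0 : ℝ) ≤ m - n := sub_nonneg.2 (by exact_mod_cast hn)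
    rw [← Real.sq_sqrt (show 0 ≤ 3 / κ * (m - n) * Real.log m by positivity)]
    exact pow_le_pow_left₀ (abs_nonneg _) h2 2

end IID

/-! ### Moments of last times -/

section Moments

variable {Ω : Type*} [MeasurableSpace Ω]

/-- The `p`-th power of a supremum of bad times `n` is at most the sum of `n ^ p` over all bad `n`.
Integrate term by term. -/
lemma timeMoment_lastBelow_le {μ : Measure Ω} {w : ℕ → Ω → ℝ} (hw : ∀ n, Measurable (w n))
    (c : ℝ) {p : ℝ} (hp : 0 < p) :
    timeMoment μ (fun ω => lastBelow (fun n => w n ω) c) p ≤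
      ∑' n : ℕ, (n : ℝ≥0∞) ^ p * μ {ω | 1 ≤ n ∧ w n ω < n * c} := by
  have hmeas : ∀ n : ℕ, MeasurableSet {ω | 1 ≤ n ∧ w n ω < n * c} := fun n =>
    (MeasurableSet.const _).inter (measurableSet_lt (hw n) measurable_const)
  calc _ ≤ ∫⁻ ω, ∑' n : ℕ, {ω | 1 ≤ n ∧ w n ω < n * c}.indicator
        (fun _ => (n : ℝ≥0∞) ^ p) ω ∂μ := by
        refine lintegral_mono fun ω => ?_
        rw [← ENNReal.le_rpow_inv_iff hp]
        simp only [lastBelow, ENat.toENNReal_iSup, ENat.toENNReal_coe]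
        refine iSup₂_le fun n hn => ?_
        rw [ENNReal.le_rpow_inv_iff hp]
        refine le_trans ?_ (ENNReal.le_tsum n)
        rw [Set.indicator_of_mem (show ω ∈ {ω | 1 ≤ n ∧ w n ω < n * c} from hn)]
    _ = _ := by
        rw [lintegral_tsum fun n => (measurable_const.indicator (hmeas n)).aemeasurable]
        exact tsum_congr fun n => lintegral_indicator_const (hmeas n) _

/-- Bound `max T U ^ p` by `T ^ p + U ^ p`. Measurability of `U` alone splits the integral; in the
application `T` is `lastDeviation`. -/
lemma timeMoment_lt_top_of_le_max {μ : Measure Ω} {S T U : Ω → ℕ∞} {p : ℝ} (hp : 0 ≤ p)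
    (hU : Measurable U) (h : ∀ᵐ ω ∂μ, S ω ≤ max (T ω) (U ω))
    (hT : timeMoment μ T p < ∞) (hU' : timeMoment μ U p < ∞) : timeMoment μ S p < ∞ := by
  have hm : Measurable fun ω => ((U ω : ℕ∞) : ℝ≥0∞) ^ p :=
    (Measurable.of_discrete.comp hU).pow_const p
  refine lt_of_le_of_lt ?_ (ENNReal.add_lt_top.2 ⟨hT, hU'⟩)
  rw [timeMoment, timeMoment, timeMoment, ← lintegral_add_right _ hm]
  refine lintegral_mono_ae ?_
  filter_upwards [h] with ω hω
  rcases le_max_iff.1 hω with h | h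
  · exact le_add_right (ENNReal.rpow_le_rpow (ENat.toENNReal_le.2 h) hp)
  · exact le_add_left (ENNReal.rpow_le_rpow (ENat.toENNReal_le.2 h) hp)

lemma measurable_lastBelow {w : ℕ → Ω → ℝ} (hw : ∀ n, Measurable (w n)) (c : ℝ) :
    Measurable fun ω => lastBelow (fun n => w n ω) c := by
  classical
  have := borelSpace_enat
  simp only [lastBelow, iSup_eq_if]
  exact Measurable.iSup fun n => Measurable.ite ((MeasurableSet.const _).inter
    (measurableSet_lt (hw n) measurable_const)) measurable_const measurable_const

end Moments

/-! ### Tail moments, law of large numbers and central limit theorem -/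

section IID

variable {𝒳 Ω : Type*} [Fintype 𝒳] [MeasurableSpace 𝒳] [MeasurableSingletonClass 𝒳]
  [MeasurableSpace Ω] {X : ℕ → Ω → 𝒳} {P : Measure 𝒳} {μ : Measure Ω}

/-- The last time at which the sample mean is below its expectation by a fixed amount has moments
of all orders. -/
lemma IsIIDSample.timeMoment_lastBelow_lt_top [IsProbabilityMeasure μ] (h : IsIIDSample X P μ)
    (f : 𝒳 → ℝ) {η p : ℝ} (hη : 0 < η) (hp : 0 < p) :
    timeMoment μ (fun ω => lastBelow (fun n => centeredSum f P X n ω) (-η)) p < ∞ := by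
  obtain ⟨κ, hκ, htail⟩ := h.exists_tail_bound f
  refine (timeMoment_lastBelow_le (measurable_centeredSum h.measurable f) _ hp).trans_lt ?_
  -- Hoeffding at `t = n η` over `n` terms has exponent `-κ η² n`, which beats any power of `n`; `p`
  -- is rounded up to a natural exponent.
  have hsum : Summable fun n : ℕ => (n : ℝ) ^ ⌈p⌉₊ * Real.exp (-(κ * η ^ 2) * n) * 2 :=
    (Real.summable_pow_mul_exp_neg_nat_mul ⌈p⌉₊ (by positivity)).mul_right 2
  refine lt_of_le_of_lt (ENNReal.tsum_le_tsum fun n => ?_) hsum.tsum_ofReal_lt_top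
  rcases Nat.eq_zero_or_pos n with rfl | hn
  · simp
  have hn0 : (0 : ℝ) < n := by exact_mod_cast hn
  have h1 : (n : ℝ≥0∞) ^ p ≤ ENNReal.ofReal ((n : ℝ) ^ ⌈p⌉₊) := by
    rw [ENNReal.ofReal_pow hn0.le, ENNReal.ofReal_natCast, ← ENNReal.rpow_natCast]
    exact ENNReal.rpow_le_rpow_of_exponent_le (by exact_mod_cast hn) (Nat.le_ceil p)
  have h2 : μ {ω | 1 ≤ n ∧ centeredSum f P X n ω < n * -η} ≤
      ENNReal.ofReal (2 * Real.exp (-(κ * η ^ 2) * n)) := by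
    rw [← ofReal_measureReal]
    refine ENNReal.ofReal_le_ofReal ?_
    calc _ ≤ μ.real {ω | n * η ≤ |∑ k ∈ Finset.range n, (f (X k ω) - ∫ x, f x ∂P)|} := by
          refine measureReal_mono fun ω hω => ?_
          have h3 : centeredSum f P X n ω < n * -η := hω.2
          change n * η ≤ |centeredSum f P X n ω|
          linarith [neg_le_abs (centeredSum f P X n ω)]
      _ ≤ _ := htail _ _ (by positivity)
      _ = _ := by
          rw [Finset.card_range]
          congr 2
          field_simp
  calc _ ≤ ENNReal.ofReal ((n : ℝ) ^ ⌈p⌉₊) * ENNReal.ofReal (2 * Real.exp (-(κ * η ^ 2) * n)) := by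
        gcongr
    _ = _ := by
        rw [← ENNReal.ofReal_mul (by positivity)]
        congr 1
        ring

/-- The strong law of large numbers for the centered sums. -/
lemma IsIIDSample.ae_tendsto_centeredSum_div [IsProbabilityMeasure μ] (h : IsIIDSample X P μ)
    (f : 𝒳 → ℝ) : ∀ᵐ ω ∂μ, Tendsto (fun n : ℕ => centeredSum f P X n ω / n) atTop (𝓝 0) := by
  obtain ⟨B, -, hB⟩ := exists_abs_le fun x => f x - ∫ x, f x ∂P
  have hf : Measurable fun x => f x - ∫ x, f x ∂P := measurable_of_finite _
  have hint : Integrable (fun ω => f (X 0 ω) - ∫ x, f x ∂P) μ :=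
    Integrable.of_bound (hf.comp (h.measurable 0)).aestronglyMeasurable B
      (Eventually.of_forall fun ω => hB _)
  have hind : iIndepFun (fun k ω => f (X k ω) - ∫ x, f x ∂P) μ :=
    h.iIndepFun_comp fun x => f x - ∫ x, f x ∂P
  have h0 : ∫ ω, (f (X 0 ω) - ∫ x, f x ∂P) ∂μ = 0 := by
    obtain ⟨B', -, hB'⟩ := exists_abs_le f
    rw [integral_sub, h.integral_comp f, integral_const, probReal_univ, one_smul, sub_self]
    · exact Integrable.of_bound
        ((measurable_of_finite f).comp (h.measurable 0)).aestronglyMeasurable B'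
        (Eventually.of_forall fun ω => hB' _)
    · exact integrable_const _
  have := strong_law_ae_real (fun k ω => f (X k ω) - ∫ x, f x ∂P) hint
    (fun i j hij => hind.indepFun hij) (fun k => h.identDistrib (fun x => f x - ∫ x, f x ∂P) k)
  rwa [h0] at this

/-- The central limit theorem for the centered sums, with the sign reversed. -/
lemma IsIIDSample.tendstoInDistribution_neg_centeredSum [IsProbabilityMeasure μ]
    (h : IsIIDSample X P μ) (f : 𝒳 → ℝ) (hV : 0 < Var[f; P]) :
    TendstoInDistribution (fun (n : ℕ) ω => (√n)⁻¹ * (-centeredSum f P X n ω / √Var[f; P]))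
      atTop (id : ℝ → ℝ) (fun _ => μ) (gaussianReal 0 1) := by
  -- The sign is that of the fluctuation of the passage time: a high walk crosses early.
  set g : 𝒳 → ℝ := fun x => -(f x - ∫ x, f x ∂P) / √Var[f; P] with hg
  have : IsProbabilityMeasure P := by
    rw [← h.law 0]; exact Measure.isProbabilityMeasure_map (h.measurable 0).aemeasurable
  have hintf : ∀ f : 𝒳 → ℝ, Integrable f P := fun f => by
    obtain ⟨B, -, hB⟩ := exists_abs_le f
    exact Integrable.of_bound (measurable_of_finite f).aestronglyMeasurable B
      (Eventually.of_forall hB)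
  have h0 : ∫ ω, g (X 0 ω) ∂μ = 0 := by
    rw [h.integral_comp g, hg, integral_div, integral_neg, integral_sub (hintf _) (hintf _)]
    simp
  have h1 : ∫ ω, g (X 0 ω) ^ 2 ∂μ = 1 := by
    rw [h.integral_comp (fun x => g x ^ 2)]
    simp only [hg, div_pow, neg_sq]
    rw [integral_div, ← variance_eq_integral (measurable_of_finite f).aemeasurable,
      Real.sq_sqrt hV.le, div_self hV.ne']
  have hY : HasLaw (id : ℝ → ℝ) (gaussianReal 0 1) (gaussianReal 0 1) :=
    ⟨aemeasurable_id, Measure.map_id⟩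
  have key := tendstoInDistribution_inv_sqrt_mul_sum hY h0 h1 (h.iIndepFun_comp g)
    (h.identDistrib g)
  convert key using 4
  simp only [hg, centeredSum, ← Finset.sum_div, Finset.sum_neg_distrib]

end IID

/-! ### Likelihood ratios, divergence and drift -/

section Likelihood

variable {𝒳 Ω : Type*} [MeasurableSpace 𝒳] [MeasurableSpace Ω] {X : ℕ → Ω → 𝒳}
  {P P₀ P₁ : Measure 𝒳} {μ : Measure Ω}

/-- Used to discard letters of mass zero, where `Real.logb` takes its default value `0` and
logarithms of products and quotients fail to split. -/
lemma ae_real_singleton_pos [Countable 𝒳] (P : Measure 𝒳) [IsFiniteMeasure P] :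
    ∀ᵐ x ∂P, 0 < P.real {x} := by
  rw [ae_iff_of_countable]
  intro x hx
  exact ENNReal.toReal_pos hx (measure_ne_top _ _)

lemma IsIIDSample.ae_forall_of_ae (h : IsIIDSample X P μ) {p : 𝒳 → Prop} (hp : ∀ᵐ x ∂P, p x) :
    ∀ᵐ ω ∂μ, ∀ k, p (X k ω) := by
  refine ae_all_iff.2 fun k => ?_
  rw [← h.law k] at hp
  exact ae_of_ae_map (h.measurable k).aemeasurable hp

lemma absolutelyContinuous_of_klBits_ne_top (h : klBits P₁ P₀ ≠ ∞) : P₁ ≪ P₀ := by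
  have hk : klDiv P₁ P₀ ≠ ∞ := fun hk => h (by
    rw [klBits, hk]; exact ENNReal.top_div_of_ne_top ENNReal.ofReal_ne_top)
  exact (klDiv_ne_top_iff.1 hk).1

lemma logProb_sub_logProb {n : ℕ} {x : Fin n → 𝒳} (h1 : ∀ i, 0 < P₁.real {x i})
    (h0 : ∀ i, 0 < P₀.real {x i}) :
    logProb P₁ x - logProb P₀ x = ∑ i, logLR P₁ P₀ (x i) := by
  rw [logProb, logProb, Real.logb_prod _ _ fun i _ => (h1 i).ne',
    Real.logb_prod _ _ fun i _ => (h0 i).ne', ← Finset.sum_sub_distrib]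
  exact Finset.sum_congr rfl fun i _ => (Real.logb_div (h1 i).ne' (h0 i).ne').symm

lemma measurable_sample (hX : ∀ k, Measurable (X k)) (n : ℕ) : Measurable (sample X n) :=
  measurable_pi_lambda _ fun i => hX i

variable [Fintype 𝒳]

/-- Under `H₁`, the test statistic is a random walk with drift, up to the redundancy. -/
lemma IsIIDSample.ae_testStat_eq [IsProbabilityMeasure P₀] [IsProbabilityMeasure P₁]
    (h : IsIIDSample X P₁ μ) (hac : P₁ ≪ P₀) (L : (n : ℕ) → (Fin n → 𝒳) → ℝ) (lam : ℝ) :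
    ∀ᵐ ω ∂μ, ∀ n, testStat L P₀ lam X n ω = n * drift P₁ P₀ lam +
      centeredSum (logLR P₁ P₀) P₁ X n ω - redundancy L P₁ X n ω := by
  filter_upwards [h.ae_forall_of_ae (ae_real_singleton_pos P₁),
    h.ae_forall_of_ae (hac.ae_le (ae_real_singleton_pos P₀))] with ω h1 h0 n
  have key := logProb_sub_logProb (x := sample X n ω) (fun i => h1 i) (fun i => h0 i)
  have hs : ∑ i, logLR P₁ P₀ (sample X n ω i) = ∑ k ∈ Finset.range n, logLR P₁ P₀ (X k ω) :=
    Fin.sum_univ_eq_sum_range (fun k => logLR P₁ P₀ (X k ω)) n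
  rw [hs] at key
  rw [testStat, redundancy, centeredSum, Finset.sum_sub_distrib, ← key, drift]
  simp only [Finset.sum_const, Finset.card_range, nsmul_eq_mul]
  ring

variable [MeasurableSingletonClass 𝒳]

/-- The divergence in bits is the expected log-likelihood ratio. -/
lemma toReal_klBits [IsProbabilityMeasure P₀] [IsProbabilityMeasure P₁] (hac : P₁ ≪ P₀) :
    (klBits P₁ P₀).toReal = ∫ x, logLR P₁ P₀ x ∂P₁ := by
  have hlog : 0 ≤ Real.log 2 := Real.log_nonneg one_le_two
  rw [klBits, ENNReal.toReal_div, ENNReal.toReal_ofReal hlog,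
    toReal_klDiv_of_measure_eq hac (by simp), ← integral_div]
  refine integral_congr_ae ?_
  filter_upwards [ae_real_singleton_pos P₁, hac.ae_le (ae_real_singleton_pos P₀)] with x h1 h0
  -- At an atom the Radon–Nikodym derivative is the quotient of the two masses.
  have h2 : P₁ {x} = P₁.rnDeriv P₀ x * P₀ {x} := by
    conv_lhs => rw [← Measure.withDensity_rnDeriv_eq P₁ P₀ hac]
    rw [withDensity_apply _ (measurableSet_singleton x), lintegral_singleton]
  rw [logLR, llr, Real.logb, Measure.real, h2, ENNReal.toReal_mul]
  congr 2
  exact (mul_div_cancel_right₀ _ h0.ne').symm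

/-- The drift is the divergence minus `λ/2`, hence at least `λ/2`. -/
lemma drift_pos [IsProbabilityMeasure P₀] [IsProbabilityMeasure P₁] {lam : ℝ} (hlam : 0 < lam)
    (hle : ENNReal.ofReal lam ≤ klBits P₁ P₀) (hne : klBits P₁ P₀ ≠ ∞) :
    0 < drift P₁ P₀ lam := by
  rw [drift, ← toReal_klBits (absolutelyContinuous_of_klBits_ne_top hne)]
  have := (ENNReal.ofReal_le_iff_le_toReal hne).1 hle
  linarith

lemma measurable_testStat (hX : ∀ k, Measurable (X k)) (L : (n : ℕ) → (Fin n → 𝒳) → ℝ)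
    (P₀ : Measure 𝒳) (lam : ℝ) (n : ℕ) : Measurable (testStat L P₀ lam X n) :=
  (measurable_of_finite fun x : Fin n → 𝒳 => -L n x - logProb P₀ x - n * (lam / 2)).comp
    (measurable_sample hX n)

end Likelihood

/-! ### The statistic and its stopping times under each hypothesis -/

lemma tendstoInMeasure_of_ae_tendsto {ι Ω : Type*} [MeasurableSpace Ω] {μ : Measure Ω}
    [IsFiniteMeasure μ] {l : Filter ι} [l.IsCountablyGenerated] {f : ι → Ω → ℝ} {g : Ω → ℝ}
    (hf : ∀ i, AEStronglyMeasurable (f i) μ)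
    (h : ∀ᵐ ω ∂μ, Tendsto (fun i => f i ω) l (𝓝 (g ω))) : TendstoInMeasure μ f l g := by
  intro ε hε
  refine tendsto_of_seq_tendsto fun x hx => ?_
  exact tendstoInMeasure_of_tendsto_ae (f := fun n => f (x n)) (fun n => hf (x n))
    (by filter_upwards [h] with ω hω using hω.comp hx) ε hε

lemma PointwiseUniversal.ae_tendsto_neg_testStat_div {𝒳 Ω : Type*} [MeasurableSpace 𝒳]
    [MeasurableSpace Ω] {L : (n : ℕ) → (Fin n → 𝒳) → ℝ} {P₀ : Measure 𝒳} {X : ℕ → Ω → 𝒳}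
    {μ : Measure Ω} {lam : ℝ} (hU : PointwiseUniversal L P₀ X μ) :
    ∀ᵐ ω ∂μ, Tendsto (fun n : ℕ => -testStat L P₀ lam X n ω / n) atTop (𝓝 (lam / 2)) := by
  filter_upwards [hU] with ω hω
  have := hω.add_const (lam / 2)
  rw [zero_add] at this
  refine this.congr' ?_
  filter_upwards [eventually_gt_atTop 0] with n hn
  rw [testStat, redundancy]
  field_simp
  ring

/-- The slope `λ/4` is half the drift `λ/2`: lying below it forces the redundancy under `-n λ/4`. -/
lemma lastBelow_neg_testStat_le {𝒳 Ω : Type*} [MeasurableSpace 𝒳]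
    {L : (n : ℕ) → (Fin n → 𝒳) → ℝ} {P₀ : Measure 𝒳} {X : ℕ → Ω → 𝒳} {lam : ℝ} (ω : Ω) :
    lastBelow (fun n => -testStat L P₀ lam X n ω) (lam / 4) ≤
      lastDeviation L P₀ X (lam / 4) ω := by
  refine biSup_mono fun n hn => ⟨hn.1, ?_⟩
  have h := hn.2
  simp only [testStat] at h
  refine lt_of_lt_of_le ?_ (le_abs_self _)
  linarith

section

variable {𝒳 Ω : Type*} [Fintype 𝒳] [MeasurableSpace 𝒳] [MeasurableSingletonClass 𝒳]
  [MeasurableSpace Ω] {X : ℕ → Ω → 𝒳} {P₀ P₁ : Measure 𝒳} {μ : Measure Ω}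
  [IsProbabilityMeasure P₀] [IsProbabilityMeasure P₁] [IsProbabilityMeasure μ]
  {L : (n : ℕ) → (Fin n → 𝒳) → ℝ} {lam : ℝ}

/-- Under `H₁`, the test statistic grows linearly at the rate `drift P₁ P₀ lam`. -/
lemma IsIIDSample.ae_tendsto_testStat_div (h : IsIIDSample X P₁ μ) (hac : P₁ ≪ P₀)
    (hU : PointwiseUniversal L P₁ X μ) :
    ∀ᵐ ω ∂μ, Tendsto (fun n : ℕ => testStat L P₀ lam X n ω / n) atTop
      (𝓝 (drift P₁ P₀ lam)) := by
  filter_upwards [hU, h.ae_testStat_eq hac L lam, h.ae_tendsto_centeredSum_div (logLR P₁ P₀)]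
    with ω h1 h2 h3
  have := (h3.sub h1).const_add (drift P₁ P₀ lam)
  rw [sub_zero, add_zero] at this
  refine this.congr' ?_
  filter_upwards [eventually_gt_atTop 0] with n hn
  rw [h2]
  field_simp
  ring

/-- A deficit of more than `n d / 2` must come from the walk falling below `-n d / 4` or from a
redundancy above `n d / 4`. The first has moments by concentration, the second by hypothesis. -/
lemma IsIIDSample.timeMoment_lastBelow_testStat_lt_top (h : IsIIDSample X P₁ μ) (hac : P₁ ≪ P₀)
    (hd : 0 < drift P₁ P₀ lam) {p : ℝ} (hp : 1 ≤ p)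
    (hdev : ∀ ε : ℝ, 0 < ε → timeMoment μ (lastDeviation L P₁ X ε) p < ∞) :
    timeMoment μ (fun ω => lastBelow (fun n => testStat L P₀ lam X n ω)
      (drift P₁ P₀ lam / 2)) p < ∞ := by
  set d := drift P₁ P₀ lam with hdd
  have hp0 : 0 < p := by linarith
  refine timeMoment_lt_top_of_le_max hp0.le
    (measurable_lastBelow (measurable_centeredSum (P := P₁) h.measurable (logLR P₁ P₀)) (-(d / 4)))
    ?_ (hdev (d / 4) (by positivity))
    (h.timeMoment_lastBelow_lt_top (logLR P₁ P₀) (by positivity) hp0)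
  filter_upwards [h.ae_testStat_eq hac L lam] with ω hω
  refine iSup₂_le fun n hn => ?_
  obtain ⟨hn1, hn2⟩ := hn
  simp only [hω, ← hdd] at hn2
  rcases lt_or_ge (centeredSum (logLR P₁ P₀) P₁ X n ω) (n * -(d / 4)) with hlt | hge
  · exact le_max_of_le_right (le_iSup₂ (f := fun (n : ℕ)
      (_ : n ∈ {n : ℕ | 1 ≤ n ∧ centeredSum (logLR P₁ P₀) P₁ X n ω < n * -(d / 4)}) => (n : ℕ∞))
      n ⟨hn1, hlt⟩)
  · refine le_max_of_le_left (le_iSup₂ (f := fun (n : ℕ) (_ : n ∈ {n : ℕ | 1 ≤ n ∧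
      n * (d / 4) < |-L n (sample X n ω) - logProb P₁ (sample X n ω)|}) => (n : ℕ∞))
      n ⟨hn1, ?_⟩)
    rw [redundancy] at hn2
    refine lt_of_lt_of_le ?_ (neg_le_abs _)
    linarith

/-- Asymptotic normality of the stopping time under `H₁`. -/
lemma IsIIDSample.tendstoInDistribution_stopN (h : IsIIDSample X P₁ μ) (hac : P₁ ≪ P₀)
    (hd : 0 < drift P₁ P₀ lam) (hU : PointwiseUniversal L P₁ X μ)
    (hV : 0 < Var[logLR P₁ P₀; P₁])
    (hr : ∀ᵐ ω ∂μ, Tendsto (fun n : ℕ => redundancy L P₁ X n ω / √n) atTop (𝓝 0)) :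
    TendstoInDistribution
      (fun (e : ℝ × ℝ) (ω : Ω) =>
        (((stopN (fun n => testStat L P₀ lam X n ω) e.1 e.2).toNat : ℝ) -
            (drift P₁ P₀ lam)⁻¹ * |Real.logb 2 e.1|) /
          √(Var[logLR P₁ P₀; P₁] * (drift P₁ P₀ lam)⁻¹ ^ 3 * |Real.logb 2 e.1|))
      errToZero (id : ℝ → ℝ) (fun _ => μ) (gaussianReal 0 1) := by
  set d := drift P₁ P₀ lam with hdd
  set V := Var[logLR P₁ P₀; P₁] with hVdef
  set u := centeredSum (logLR P₁ P₀) P₁ X with hu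
  set a : ℝ × ℝ → ℝ := fun e => -Real.logb 2 e.1 with hadef
  have ha : Tendsto a errToZero atTop := tendsto_neg_logb_fst
  set ν : ℝ × ℝ → ℕ := fun e => ⌊a e / d⌋₊ with hνdef
  have hν : Tendsto ν errToZero atTop :=
    tendsto_nat_floor_atTop.comp (ha.atTop_div_const hd)
  have hmeasu : ∀ n, Measurable (u n) := measurable_centeredSum h.measurable _
  -- the central limit theorem along `⌊a / d⌋`
  have hclt : TendstoInDistribution (fun e ω => (√(ν e : ℝ))⁻¹ * (-u (ν e) ω / √V))
      errToZero (id : ℝ → ℝ) (fun _ => μ) (gaussianReal 0 1) := by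
    have h0 := h.tendstoInDistribution_neg_centeredSum (logLR P₁ P₀) hV
    exact ⟨fun e => h0.forall_aemeasurable (ν e), h0.aemeasurable_limit, h0.tendsto.comp hν⟩
  -- Removes the rounding in `ν` from the normalization, as a Slutsky factor tending to `1`.
  have hratio : Tendsto (fun e => √(ν e : ℝ) / √(a e / d)) errToZero (𝓝 1) := by
    have h1 : Tendsto (fun e => (ν e : ℝ) / (a e / d)) errToZero (𝓝 1) :=
      (tendsto_nat_floor_div_atTop (R := ℝ)).comp (ha.atTop_div_const hd)
    have h2 := h1.sqrt
    rw [Real.sqrt_one] at h2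
    refine h2.congr fun e => ?_
    rw [Real.sqrt_div (Nat.cast_nonneg _)]
  have hclt' : TendstoInDistribution
      (fun e ω => (√(ν e : ℝ))⁻¹ * (-u (ν e) ω / √V) * (√(ν e : ℝ) / √(a e / d)))
      errToZero (id : ℝ → ℝ) (fun _ => μ) (gaussianReal 0 1) := by
    have := hclt.continuous_comp_prodMk_of_tendstoInMeasure_const
      (g := fun x : ℝ × ℝ => x.1 * x.2) (by fun_prop)
      (Y := fun e _ => √(ν e : ℝ) / √(a e / d)) (c := 1)
      (tendstoInMeasure_of_ae_tendsto (fun e => aestronglyMeasurable_const)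
        (Eventually.of_forall fun _ => hratio))
      (fun e => aemeasurable_const)
    simp only [mul_one] at this
    exact this
  have hTmeas : ∀ e : ℝ × ℝ, Measurable fun ω =>
      (((stopN (fun n => testStat L P₀ lam X n ω) e.1 e.2).toNat : ℝ) -
          d⁻¹ * |Real.logb 2 e.1|) / √(V * d⁻¹ ^ 3 * |Real.logb 2 e.1|) := fun e => by
    have hN : Measurable fun ω => stopN (fun n => testStat L P₀ lam X n ω) e.1 e.2 :=
      measurable_exitTime (measurable_testStat h.measurable L P₀ lam) _ _
    exact (((Measurable.of_discrete (f := fun n : ℕ∞ => (n.toNat : ℝ))).comp hN).sub_const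
      _).div_const _
  -- Slutsky's lemma: it remains to show that the difference from the normalized walk at the
  -- deterministic time `ν` vanishes almost surely.
  refine tendstoInDistribution_of_tendstoInMeasure_sub _ _ hclt' ?_
    fun e => (hTmeas e).aemeasurable
  refine tendstoInMeasure_of_ae_tendsto (fun e => ?_) ?_
  · exact ((hTmeas e).sub ((((hmeasu (ν e)).neg.div_const _).const_mul _).mul_const
      _)).aestronglyMeasurable
  obtain ⟨B, -, hB⟩ := exists_abs_le fun x => logLR P₁ P₀ x - ∫ x, logLR P₁ P₀ x ∂P₁
  obtain ⟨A, hA⟩ := h.ae_modulus (logLR P₁ P₀)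
  filter_upwards [hA, hr, h.ae_testStat_eq hac L lam,
    h.ae_tendsto_testStat_div (lam := lam) hac hU] with ω h1 h2 h3 h4
  have key := (tendsto_passage_add_div_sqrt (u := fun n => u n ω) hd h3
    (by simp [hu, centeredSum]) (B := B) (fun n => by
      simp only [hu, centeredSum, Finset.sum_range_succ, add_sub_cancel_left]
      exact hB _) h2 h1 h4).comp ha
  have hw' := tendsto_atTop_of_tendsto_div hd h4
  -- Since `√(V d⁻³ a) = √V √a / (d √d)`, the difference is this constant times the pathwise error
  -- over `√a`.
  have key' := key.const_mul (√d / √V)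
  rw [mul_zero] at key'
  refine key'.congr' ?_
  filter_upwards [eventually_exitTime_eq_hitTime hw' tendsto_logb_snd a,
    eventually_abs_logb_fst, ha.eventually_gt_atTop 0, hν.eventually_gt_atTop 0]
    with e he1 he2 he3 he4
  have hτ : stopN (fun n => testStat L P₀ lam X n ω) e.1 e.2 =
      passage (fun n => testStat L P₀ lam X n ω) (a e) := by
    rw [stopN_eq_exitTime, ← hitTime_eq_passage hw', ← he1]
  have hroot : √(V * d⁻¹ ^ 3 * a e) = √V * √(a e) / (d * √d) := by
    rw [Real.sqrt_mul (by positivity), Real.sqrt_mul hV.le, inv_pow, Real.sqrt_inv,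
      show d ^ 3 = d ^ 2 * d by ring, Real.sqrt_mul (by positivity), Real.sqrt_sq hd.le]
    ring
  have hν0 : (0 : ℝ) < ν e := by exact_mod_cast he4
  have p1 := Real.sqrt_pos.2 hν0
  have p2 := Real.sqrt_pos.2 he3
  have p3 := Real.sqrt_pos.2 hV
  have p4 := Real.sqrt_pos.2 hd
  simp only [Function.comp, Pi.sub_apply]
  rw [hτ, he2]
  change _ = ((passage (fun n => testStat L P₀ lam X n ω) (a e) : ℝ) - d⁻¹ * a e) /
    √(V * d⁻¹ ^ 3 * a e) - _
  rw [hroot, Real.sqrt_div he3.le]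
  change √d / √V * ((_ * d - a e + u (ν e) ω) / √(a e)) = _
  field_simp
  ring

end

end UniversalSequentialTest

/-! ### Assembly of the two hypotheses -/

theorem mainTheorem2
    {𝒳 : Type*} [Fintype 𝒳] [MeasurableSpace 𝒳] [MeasurableSingletonClass 𝒳]
    {Ω : Type*} [MeasurableSpace Ω]
    (X : ℕ → Ω → 𝒳)
    (P₀ P₁ : Measure 𝒳) [IsProbabilityMeasure P₀] [IsProbabilityMeasure P₁]
    (μ₀ μ₁ : Measure Ω) [IsProbabilityMeasure μ₀] [IsProbabilityMeasure μ₁]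
    (L : (n : ℕ) → (Fin n → 𝒳) → ℝ)
    (lam : ℝ) (hlam : 0 < lam) :
    -- (a): behaviour under `H₀`
    (IsIIDSample X P₀ μ₀ → PointwiseUniversal L P₀ X μ₀ →
      (∀ᵐ ω ∂μ₀, Tendsto
        (fun e : ℝ × ℝ =>
          ((stopN (fun n => testStat L P₀ lam X n ω) e.1 e.2 : ℕ∞) : ℝ≥0∞) /
            ENNReal.ofReal |Real.logb 2 e.2|)
        errToZero (𝓝 (ENNReal.ofReal (2 / lam)))) ∧
      (∀ p : ℝ, 1 ≤ p →
        (∀ ε : ℝ, 0 < ε → timeMoment μ₀ (lastDeviation L P₀ X ε) p < ∞) →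
        logMoment μ₀ P₀ X (p + 1) < ∞ →
        ∀ q : ℝ, 0 < q → q ≤ p →
          Tendsto
            (fun e : ℝ × ℝ =>
              timeMoment μ₀ (fun ω => stopN (fun n => testStat L P₀ lam X n ω) e.1 e.2) q /
                ENNReal.ofReal (|Real.logb 2 e.2| ^ q))
            errToZero (𝓝 (ENNReal.ofReal ((2 / lam) ^ q))) ∧
          Tendsto
            (fun e : ℝ × ℝ =>
              timeMoment μ₀ (fun ω => stopN0 (fun n => testStat L P₀ lam X n ω) e.2) q /
                ENNReal.ofReal (|Real.logb 2 e.2| ^ q))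
            errToZero (𝓝 (ENNReal.ofReal ((2 / lam) ^ q))))) ∧
    -- (b): behaviour under `H₁`
    (IsIIDSample X P₁ μ₁ → PointwiseUniversal L P₁ X μ₁ →
      ENNReal.ofReal lam ≤ klBits P₁ P₀ → klBits P₁ P₀ ≠ ∞ →
      (∀ᵐ ω ∂μ₁, Tendsto
        (fun e : ℝ × ℝ =>
          ((stopN (fun n => testStat L P₀ lam X n ω) e.1 e.2 : ℕ∞) : ℝ≥0∞) /
            ENNReal.ofReal |Real.logb 2 e.1|)
        errToZero (𝓝 (ENNReal.ofReal (1 / drift P₁ P₀ lam)))) ∧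
      (∀ p : ℝ, 1 ≤ p →
        (∀ ε : ℝ, 0 < ε → timeMoment μ₁ (lastDeviation L P₁ X ε) p < ∞) →
        logMoment μ₁ P₁ X (p + 1) < ∞ →
        logMoment μ₁ P₀ X (p + 1) < ∞ →
        ∀ q : ℝ, 0 < q → q ≤ p →
          Tendsto
            (fun e : ℝ × ℝ =>
              timeMoment μ₁ (fun ω => stopN (fun n => testStat L P₀ lam X n ω) e.1 e.2) q /
                ENNReal.ofReal (|Real.logb 2 e.1| ^ q))
            errToZero (𝓝 (ENNReal.ofReal ((1 / drift P₁ P₀ lam) ^ q))) ∧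
          Tendsto
            (fun e : ℝ × ℝ =>
              timeMoment μ₁ (fun ω => stopN1 (fun n => testStat L P₀ lam X n ω) e.1) q /
                ENNReal.ofReal (|Real.logb 2 e.1| ^ q))
            errToZero (𝓝 (ENNReal.ofReal ((1 / drift P₁ P₀ lam) ^ q)))) ∧
      -- `Var[logLR P₁ P₀; P₁]` is `ρ²`
      (evariance (logLR P₁ P₀) P₁ < ∞ → 0 < Var[logLR P₁ P₀; P₁] →
        (∀ᵐ ω ∂μ₁, Tendsto (fun n : ℕ => redundancy L P₁ X n ω / Real.sqrt n) atTop (𝓝 0)) →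
        (∀ α β : ℝ, 0 < α → α < 1 → 0 < β → β < 1 →
          ∀ᵐ ω ∂μ₁, stopN (fun n => testStat L P₀ lam X n ω) α β < ⊤) ∧
        TendstoInDistribution
          (fun (e : ℝ × ℝ) (ω : Ω) =>
            (((stopN (fun n => testStat L P₀ lam X n ω) e.1 e.2).toNat : ℝ) -
                (drift P₁ P₀ lam)⁻¹ * |Real.logb 2 e.1|) /
              Real.sqrt (Var[logLR P₁ P₀; P₁] * (drift P₁ P₀ lam)⁻¹ ^ 3 * |Real.logb 2 e.1|))
          errToZero (id : ℝ → ℝ) (fun _ => μ₁) (gaussianReal 0 1))) := by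
  constructor
  · intro hX hU
    have hc : 0 < lam / 2 := by positivity
    have hmeas : ∀ n, Measurable fun ω => -testStat L P₀ lam X n ω := fun n =>
      (measurable_testStat hX.measurable L P₀ lam n).neg
    have hdiv : (2 : ℝ) / lam = 1 / (lam / 2) := by field_simp
    have hlimN : ∀ᵐ ω ∂μ₀, Tendsto (fun e : ℝ × ℝ =>
        ((stopN (fun n => testStat L P₀ lam X n ω) e.1 e.2 : ℕ∞) : ℝ≥0∞) /
          ENNReal.ofReal (-Real.logb 2 e.2)) errToZero (𝓝 (ENNReal.ofReal (1 / (lam / 2)))) := by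
      filter_upwards [hU.ae_tendsto_neg_testStat_div (lam := lam)] with ω hω
      simp only [stopN_eq_exitTime_neg]
      exact tendsto_exitTime_div hc hω tendsto_neg_logb_snd tendsto_logb_fst
    have hlimN0 : ∀ᵐ ω ∂μ₀, Tendsto (fun e : ℝ × ℝ =>
        ((stopN0 (fun n => testStat L P₀ lam X n ω) e.2 : ℕ∞) : ℝ≥0∞) /
          ENNReal.ofReal (-Real.logb 2 e.2)) errToZero (𝓝 (ENNReal.ofReal (1 / (lam / 2)))) := by
      filter_upwards [hU.ae_tendsto_neg_testStat_div (lam := lam)] with ω hω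
      simp only [stopN0_eq_hitTime_neg]
      exact (tendsto_hitTime_div hc hω).comp tendsto_neg_logb_snd
    refine ⟨?_, fun p hp hdev _ q hq hqp => ?_⟩
    · filter_upwards [hlimN] with ω hω
      rw [hdiv]
      refine hω.congr' ?_
      filter_upwards [eventually_abs_logb_snd] with e he
      rw [he]
    · have hK : timeMoment μ₀
          (fun ω => lastBelow (fun n => -testStat L P₀ lam X n ω) (lam / 4)) p < ∞ := by
        refine lt_of_le_of_lt (lintegral_mono fun ω => ?_) (hdev (lam / 4) (by positivity))
        exact ENNReal.rpow_le_rpow (ENat.toENNReal_le.2 (lastBelow_neg_testStat_le ω))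
          (by linarith)
      rw [hdiv]
      constructor
      · refine (tendsto_timeMoment_div hc (show 0 < lam / 4 by positivity) hp hq hqp
          tendsto_neg_logb_snd (fun e => ?_) (fun e ω => ?_) hlimN hK).congr' ?_
        · simp only [stopN_eq_exitTime_neg]
          exact measurable_exitTime hmeas _ _
        · rw [stopN_eq_exitTime_neg]
          exact exitTime_le_hitTime _ _ _
        · filter_upwards [eventually_abs_logb_snd] with e he
          rw [he]
      · refine (tendsto_timeMoment_div hc (show 0 < lam / 4 by positivity) hp hq hqp
          tendsto_neg_logb_snd (fun e => ?_) (fun e ω => ?_) hlimN0 hK).congr' ?_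
        · simp only [stopN0_eq_hitTime_neg]
          exact measurable_hitTime hmeas _
        · rw [stopN0_eq_hitTime_neg]
        · filter_upwards [eventually_abs_logb_snd] with e he
          rw [he]
  · intro hX hU hle hne
    have hac := absolutelyContinuous_of_klBits_ne_top hne
    have hd := drift_pos hlam hle hne
    have hmeas : ∀ n, Measurable fun ω => testStat L P₀ lam X n ω :=
      measurable_testStat hX.measurable L P₀ lam
    have hlimw := hX.ae_tendsto_testStat_div (lam := lam) hac hU
    have hlimN : ∀ᵐ ω ∂μ₁, Tendsto (fun e : ℝ × ℝ =>
        ((stopN (fun n => testStat L P₀ lam X n ω) e.1 e.2 : ℕ∞) : ℝ≥0∞) /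
          ENNReal.ofReal (-Real.logb 2 e.1)) errToZero
        (𝓝 (ENNReal.ofReal (1 / drift P₁ P₀ lam))) := by
      filter_upwards [hlimw] with ω hω
      exact tendsto_exitTime_div hd hω tendsto_neg_logb_fst tendsto_logb_snd
    have hlimN1 : ∀ᵐ ω ∂μ₁, Tendsto (fun e : ℝ × ℝ =>
        ((stopN1 (fun n => testStat L P₀ lam X n ω) e.1 : ℕ∞) : ℝ≥0∞) /
          ENNReal.ofReal (-Real.logb 2 e.1)) errToZero
        (𝓝 (ENNReal.ofReal (1 / drift P₁ P₀ lam))) := by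
      filter_upwards [hlimw] with ω hω
      exact (tendsto_hitTime_div hd hω).comp tendsto_neg_logb_fst
    refine ⟨?_, fun p hp hdev _ _ q hq hqp => ?_, fun _ hV hr => ⟨fun α β _ _ _ _ => ?_, ?_⟩⟩
    · filter_upwards [hlimN] with ω hω
      refine hω.congr' ?_
      filter_upwards [eventually_abs_logb_fst] with e he
      rw [he]
    · have hK := hX.timeMoment_lastBelow_testStat_lt_top hac hd hp hdev
      constructor
      · refine (tendsto_timeMoment_div hd (half_pos hd) hp hq hqp
          tendsto_neg_logb_fst (fun e => measurable_exitTime hmeas _ _)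
          (fun e ω => exitTime_le_hitTime _ _ _) hlimN hK).congr' ?_
        filter_upwards [eventually_abs_logb_fst] with e he
        rw [he]
        rfl
      · refine (tendsto_timeMoment_div hd (half_pos hd) hp hq hqp
          tendsto_neg_logb_fst (fun e => measurable_hitTime hmeas _)
          (fun e ω => le_rfl) hlimN1 hK).congr' ?_
        filter_upwards [eventually_abs_logb_fst] with e he
        rw [he]
        rfl
    -- The statistic tends to `+∞` almost surely, so it crosses every upper level.
    · filter_upwards [hlimw] with ω hω
      refine (exitTime_le_hitTime _ _ _).trans_lt ?_
      rw [hitTime_eq_passage (tendsto_atTop_of_tendsto_div hd hω)]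
      exact ENat.natCast_lt_top _
    · exact hX.tendstoInDistribution_stopN hac hd hU hV hr
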